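/- **Setting.** A game arena is a directed graph $G=(V,E)$ with $V=V_0\sqcup V_1$; Player $i$ moves at vertices of $V_i$. Strategies of Player 0 are functions of the history, a *positional* strategy depends on the current vertex only. A winning strategy from $v$ is one for which every play from $v$ played according to it is won by Player 0. A Streett game $(G,\Omega)$, $\Omega=((E_1,F_1),\dots,(E_n,F_n))$, $E_i,F_i\subseteq V$, is won by Player 0 on a play $\varrho$ iff for each $i$: $\mathrm{Inf}(\varrho)\cap F_i\ne\emptyset$ implies $\mathrm{Inf}(\varrho)\cap E_i\neq\emptyset$, where $\mathrm{Inf}(\varrho)$ is the set of vertices visited infinitely often. A (max-)parity game with colouring $c$ is won by Player 0 iff $\max c(\mathrm{Inf}(\varrho))$ is even. The *memory size* of a strategy from $v$ is the least number of states of a finite Mealy automaton that proposes the moves of the strategy along all plays from $v$ played according to it. **Parity simulation.** Suppose $E_n=F_n=V$. Let $S$ be the set of triples $s=((i_1\cdots i_n),e,f)$ with $(i_1\cdots i_n)$ a permutation of $1,\dots,n$ and $1\le e,f\le n$, and let $s_0=((1\cdots n),1,1)$. The parity game $\Gamma'$ of $\Gamma=(G,\Omega)$ is played on $S\times V$, where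 $(s,v)$ belongs to the owner of $v$. There is an edge from $(s,v)$ to $(s',v')$ iff $(v,v')\in E$ and $s'=((i'_1\cdots i'_n),e',f')$, where $(i'_1\cdots i'_n)$ arises from $(i_1\cdots i_n)$ by shifting all $i$ with $v\in E_i$ to the left (keeping the order otherwise), $e'$ is the maximal $l$ with $v\in E_{i_l}$ and $f'$ is the maximal $l$ with $v\in F_{i'_l}$. The colour of $(((i_1\cdots i_n),e,f),v)$ is $2e$ if $e\ge f$, and $2f-1$ if $e<f$. A positional strategy $f'$ in $\Gamma'$ *yields* the strategy in $\Gamma$ that updates the memory content along the history, starting with $s_0$, and plays the $V$-component of the move of $f'$. **Reduction.** Let $E'$ be the edge relation of $\Gamma'$ and put $c'=2n-c$, where $c$ is the colouring of $\Gamma'$. On $\mathbb N$ let $i\preceq j$ iff $i$ is even and $j$ odd, or both are even and $i\le j$, or both are odd and $j\le i$. In the simulation game positions are triples $(p,q,m)$ with $p,q\in S\times V$ and $m\in\mathbb N\cup\{\checkmark\}$; Spoiler moves from $(p,q,m)$ to $(p',q',m')$ such that $(p,p'),(q,q')\in E'$, $p'$ and $q'$ have the same $V$-component, and $m'=\mathrm{pm}(c'(p'),c'(q'),m)$.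 Here $\mathrm{pm}(i,j,\checkmark)$ is $\min\{i,j\}$ if $i\prec j$, and $\checkmark$ otherwise; for $m\in\mathbb N$, $\mathrm{pm}(i,j,m)$ is $\min\{i,j,m\}$ if $i\prec j$. If $j\preceq i$, it is $m$ if $i$ is odd, $i\le m$, and ($j$ is odd or $m<j$); it is $\checkmark$ if $j$ is even, $j\le m$, and ($i$ is even or $m<i$); it is $\checkmark$ if $i$ is odd, $j$ is even and $i,j\le m$; and it is $m$ in all other cases. Duplicator wins a play iff positions with $m=\checkmark$ are visited infinitely often. Write $p\le q$ if Duplicator wins from $(p,q,\mathrm{pm}(c'(p),c'(q),\checkmark))$, and $s\approx_S t$ if $(s,v)\le(t,v)$ and $(t,v)\le(s,v)$ for all $v\in V$. The *reduced game graph* $G''$ has vertex set $S/{\approx_S}\times V$ and an edge from $([s],v)$ to $([t],v')$ whenever $(v,v')\in E$ and $t$ is the least element, for a fixed total order on $S$, of the set of all $\hat t$ such that $((\hat s,v),(\hat t,v'))\in E'$ for some $\hat s\approx_S s$. Its *memory contents* are the elements of $S/{\approx_S}$. **The games $\Gamma_k$.** Let $k\ge1$. The arena $G_k$ has the vertices $v_j,p_j^+,p_j^-,w_j,r_j^+,r_j^-$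 ($1\le j\le k$) and $x,y$; exactly $w_1,\dots,w_k$ belong to Player 0. The edges are $v_j\to p_j^\pm$, $p_j^\pm\to v_{j+1}$ ($j<k$), $p_k^\pm\to w_1$, $w_j\to r_j^\pm$, $r_j^\pm\to w_{j+1}$ ($j<k$), $r_k^\pm\to x$, $x\to y$, $y\to v_1$. The pairs are, in this order, $(E_1,F_1),(E_{-1},F_{-1}),\dots,(E_k,F_k),(E_{-k},F_{-k}),(V,V)$, where $E_j=\{p_j^-,r_j^+,y\}$, $F_j=\{p_j^+,r_j^-\}$, $E_{-j}=\{p_j^+,r_j^-,y\}$, $F_{-j}=\{p_j^-,r_j^+\}$. Let $\Gamma_k$ be this Streett game and $\Gamma'_k$ its parity game. **Theorem.** For every $k\ge1$, Player 0 wins $\Gamma_k$ from $v_1$, and the following hold. 1. Let $f'$ be a positional winning strategy for Player 0 in $\Gamma'_k$ from $(s_0,v_1)$ such that no edge determined by her decisions leads into a vertex of odd colour; that is, whenever $(s,w)$ with $w\in V_0$ is reachable from $(s_0,v_1)$ under $f'$, both the vertex $f'(s,w)$ and its (unique) successor in $\Gamma'_k$ have an even colour. Then $f'$ yields a winning strategy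 for Player 0 in $\Gamma_k$ from $v_1$, and the memory size of this strategy is at least $2^k$. 2. The reduced game graph $G''_k$ of $\Gamma_k$ has only one memory content, for every choice of the total order on $S$. -/

import Mathlib

/-! ### Infinite games, strategies and their memory -/

/-- A game arena; the vertices outside `V0` belong to Player 1. -/
structure GameGraph (V : Type) where
  V0 : Set V
  edge : V → V → Prop

/-- An infinite game: an arena with the set of sequences that are winning for Player 0. -/
structure InfGame (V : Type) extends GameGraph V where
  win : Set (ℕ → V)

/-- The set of vertices visited infinitely often. -/
def infOcc {V : Type} (ρ : ℕ → V) : Set V := {v | ∃ᶠ i in Filter.atTop, ρ i = v}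

/-- The prefix `ρ(0) ⋯ ρ(i-1)`. -/
def pastOf {V : Type} (ρ : ℕ → V) (i : ℕ) : List V := (List.range i).map ρ

namespace GameGraph

variable {V : Type} (G : GameGraph V)

def IsPlay (ρ : ℕ → V) : Prop := ∀ i, G.edge (ρ i) (ρ (i + 1))

/-- Strategies for Player 0: `f h v` is the move after the history `h` followed by the current
vertex `v`. Only the values on play prefixes `h v` with `v ∈ V0` matter. -/
def IsStrategy (f : List V → V → V) : Prop :=
  ∀ h v, List.IsChain G.edge (h ++ [v]) → v ∈ G.V0 → G.edge v (f h v)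

def PlayedAccordingTo (f : List V → V → V) (ρ : ℕ → V) : Prop :=
  ∀ i, ρ i ∈ G.V0 → ρ (i + 1) = f (pastOf ρ i) (ρ i)

/-- `f` is a positional strategy for Player 0 (its values outside `V0` are irrelevant). -/
def IsPositionalStrategy (f : V → V) : Prop := ∀ v ∈ G.V0, G.edge v (f v)

/-- The edges that can be used when Player 0 follows the positional strategy `f`. -/
def positionalEdge (f : V → V) (p q : V) : Prop := G.edge p q ∧ (p ∈ G.V0 → q = f p)

/-- The vertices that are reachable from `p₀` when Player 0 follows `f`. -/
def reachableUnder (f : V → V) (p₀ : V) : Set V :=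
  {p | Relation.ReflTransGen (G.positionalEdge f) p₀ p}

/-- The edges determined by the decisions of Player 0 when she follows the positional strategy `f`
from `p₀`: the edges that she chooses, and the edges that follow immediately upon a chosen edge. -/
def determinedEdges (f : V → V) (p₀ : V) : Set (V × V) :=
  {a | a.1 ∈ G.reachableUnder f p₀ ∧ G.positionalEdge f a.1 a.2 ∧
    (a.1 ∈ G.V0 ∨ ∃ r ∈ G.reachableUnder f p₀, r ∈ G.V0 ∧ f r = a.1)}

end GameGraph

/-- `f` is a winning strategy for Player 0 from `v`. -/
def InfGame.IsWinningStrategy {V : Type} (Γ : InfGame V) (f : List V → V → V) (v : V) : Prop :=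
  Γ.IsStrategy f ∧
    ∀ ρ : ℕ → V, Γ.IsPlay ρ → ρ 0 = v → Γ.PlayedAccordingTo f ρ → ρ ∈ Γ.win

/-- Player 0 wins from `v`. -/
def InfGame.Wins {V : Type} (Γ : InfGame V) (v : V) : Prop := ∃ f, Γ.IsWinningStrategy f v

/-- Mealy automata reading vertices and proposing moves. -/
structure Mealy (V : Type) where
  Mem : Type
  init : Mem
  next : Mem → V → Mem
  out : Mem → V → V

/-- On every play from `v` according to `f`, the automaton proposes the moves of `f`. -/
def Mealy.Implements {V : Type} (M : Mealy V) (G : GameGraph V) (f : List V → V → V) (v : V) :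
    Prop :=
  ∀ ρ : ℕ → V, G.IsPlay ρ → ρ 0 = v → G.PlayedAccordingTo f ρ →
    ∀ i, ρ i ∈ G.V0 → M.out ((pastOf ρ i).foldl M.next M.init) (ρ i) = f (pastOf ρ i) (ρ i)

/-- Every (finite) Mealy automaton that implements `f` from `v` has at least `n` states. -/
def memorySizeAtLeast {V : Type} (G : GameGraph V) (f : List V → V → V) (v : V) (n : ℕ) : Prop :=
  ∀ M : Mealy V, Finite M.Mem → M.Implements G f v → n ≤ Nat.card M.Mem

/-- The (max-)parity game of a coloured arena. -/
def parityGame {V : Type} (G : GameGraph V) (c : V → ℕ) : InfGame V where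
  toGameGraph := G
  win := {ρ | ∃ m, IsGreatest (c '' infOcc ρ) m ∧ Even m}

/-! ### Streett games and their simulation by parity games -/

/-- A Streett game with `m + 1` pairs `(E j, F j)`. -/
structure StreettGame (V : Type) (m : ℕ) extends GameGraph V where
  E : Fin (m + 1) → Set V
  F : Fin (m + 1) → Set V

/-- Index appearance records over `m + 1` indices: a permutation `(i₁ ⋯ i_{m+1})`, where
`perm l` is the index at position `l`, and two pointers to positions. Positions are counted from
`0`, so that a pointer `e` stands for the number `e + 1`. -/
structure IAR (m : ℕ) where
  perm : Equiv.Perm (Fin (m + 1))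
  e : Fin (m + 1)
  f : Fin (m + 1)

/-- The record `((1 ⋯ m+1), 1, 1)`. -/
def IAR.initial (m : ℕ) : IAR m := ⟨1, 0, 0⟩

namespace StreettGame

variable {V : Type} {m : ℕ} (Γ : StreettGame V m)

/-- The Streett winning condition. -/
def game : InfGame V where
  toGameGraph := Γ.toGameGraph
  win := {ρ | ∀ j, (infOcc ρ ∩ Γ.F j).Nonempty → (infOcc ρ ∩ Γ.E j).Nonempty}

open Classical in
/-- All indices `i` with `v ∈ E i` are shifted to the left (`Tuple.sort` is stable, so the order
among the shifted indices and the order among the other ones are kept). -/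
noncomputable def shiftLeft (v : V) (π : Equiv.Perm (Fin (m + 1))) : Equiv.Perm (Fin (m + 1)) :=
  (Tuple.sort (fun l => if v ∈ Γ.E (π l) then (0 : ℕ) else 1)).trans π

open Classical in
/-- The memory update when vertex `v` is left: `e` is the maximal position in the old permutation
of an index `i` with `v ∈ E i`, and `f` the maximal position in the new permutation of an index `i`
with `v ∈ F i`. (These exist if one of the pairs consists of two copies of the whole vertex set.) -/
noncomputable def update (s : IAR m) (v : V) : IAR m where
  perm := Γ.shiftLeft v s.perm
  e := (Finset.univ.filter (fun l => v ∈ Γ.E (s.perm l))).sup id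
  f := (Finset.univ.filter (fun l => v ∈ Γ.F (Γ.shiftLeft v s.perm l))).sup id

/-- The arena of the simulating parity game. -/
def iarGraph : GameGraph (IAR m × V) where
  V0 := {p | p.2 ∈ Γ.V0}
  edge p q := Γ.edge p.2 q.2 ∧ q.1 = Γ.update p.1 p.2

end StreettGame

/-- The colouring of the simulating parity game. -/
def iarColor {V : Type} {m : ℕ} (p : IAR m × V) : ℕ :=
  if p.1.f ≤ p.1.e then 2 * ((p.1.e : ℕ) + 1) else 2 * ((p.1.f : ℕ) + 1) - 1

namespace StreettGame

variable {V : Type} {m : ℕ} (Γ : StreettGame V m)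

/-- The parity game that simulates the Streett game. -/
def simulatingGame : InfGame (IAR m × V) := parityGame Γ.iarGraph iarColor

/-- The strategy in the Streett game that a positional strategy `f'` in the simulating game yields:
the memory content is updated along the history, starting with the initial one, and the move is the
`V`-component of the move of `f'`. -/
noncomputable def inducedStrategy (f' : IAR m × V → IAR m × V) : List V → V → V :=
  fun h v => (f' (h.foldl Γ.update (IAR.initial m), v)).2

end StreettGame

/-! ### Right-hand delayed simulation -/

/-- The reward order `i ⪯ j`. -/
def rewardLE (i j : ℕ) : Prop :=
  (Even i ∧ Odd j) ∨ (Even i ∧ Even j ∧ i ≤ j) ∨ (Odd i ∧ Odd j ∧ j ≤ i)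

/-- The strict reward order `i ≺ j` (`i` is better than `j`). -/
def rewardLT (i j : ℕ) : Prop := rewardLE i j ∧ i ≠ j

open Classical in
/-- The priority memory update; `none` stands for the check mark. -/
noncomputable def pm (i j : ℕ) : Option ℕ → Option ℕ
  | none => if rewardLT i j then some (min i j) else none
  | some k =>
    if rewardLT i j then some (min (min i j) k)
    else if Odd i ∧ i ≤ k ∧ (Odd j ∨ k < j) then some k
    else if Even j ∧ j ≤ k ∧ (Even i ∨ k < i) then none
    else if Odd i ∧ Even j ∧ i ≤ k ∧ j ≤ k then none
    else some k

section Reduction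

variable {S V : Type}

/-- The right-hand delayed simulation game for a coloured arena over `S × V` (`min`-parity).
Player 0 is Duplicator; all positions belong to Spoiler. -/
def rhGame (G' : GameGraph (S × V)) (c : S × V → ℕ) : InfGame ((S × V) × (S × V) × Option ℕ) where
  V0 := ∅
  edge a b := G'.edge a.1 b.1 ∧ G'.edge a.2.1 b.2.1 ∧ b.1.2 = b.2.1.2 ∧
    b.2.2 = pm (c b.1) (c b.2.1) a.2.2
  win := {ρ | (infOcc ρ ∩ {a | a.2.2 = none}).Nonempty}

open Classical in
noncomputable def rhInit (c : S × V → ℕ) (p q : S × V) : (S × V) × (S × V) × Option ℕ :=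
  (p, q, if rewardLT (c p) (c q) then some (min (c p) (c q)) else none)

/-- `q` right-hand delayed simulates `p`. -/
def rhLE (G' : GameGraph (S × V)) (c : S × V → ℕ) (p q : S × V) : Prop :=
  (rhGame G' c).Wins (rhInit c p q)

def rhEquiv (G' : GameGraph (S × V)) (c : S × V → ℕ) (p q : S × V) : Prop :=
  rhLE G' c p q ∧ rhLE G' c q p

/-- The relation on memory contents derived from right-hand delayed simulation. -/
def memEquiv (G' : GameGraph (S × V)) (c : S × V → ℕ) (s₁ s₂ : S) : Prop :=
  ∀ v : V, rhEquiv G' c (s₁, v) (s₂, v)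

/-- States of game automata: the states `S × V` of a game, an initial state and a sink. -/
inductive AutState (Q : Type) where
  | start : AutState Q
  | sink : AutState Q
  | state (q : Q) : AutState Q

/-- The transitions `(state, letter, state)` of the game automaton of the arena `G'` over `S × V`,
where `G` is the simulated arena and `s₀` the initial memory content. -/
inductive gameAutomaton (G : GameGraph V) (G' : GameGraph (S × V)) (s₀ : S) :
    AutState (S × V) → V → AutState (S × V) → Prop where
  | start (v' : V) : gameAutomaton G G' s₀ .start v' (.state (s₀, v'))
  | edge (s s' : S) (v v' : V) (h : G'.edge (s, v) (s', v')) :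
      gameAutomaton G G' s₀ (.state (s, v)) v' (.state (s', v'))
  | toSink (s : S) (v v' : V) (h : ¬ G.edge v v') : gameAutomaton G G' s₀ (.state (s, v)) v' .sink
  | sink (v' : V) : gameAutomaton G G' s₀ .sink v' .sink

/-- The classes of a relation on `S`, as subsets of `S`. -/
def MemClass (R : S → S → Prop) : Type := {C : Set S // ∃ s, C = {t | R s t}}

def MemClass.mk (R : S → S → Prop) (s : S) : MemClass R := ⟨{t | R s t}, s, rfl⟩

/-- The transitions of the quotient of the automaton `δ` (with initial memory content `s₀`) by a
relation on the memory contents. The successor of a class is the class of the least successor of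
its elements, with respect to a fixed total order on `S`. -/
inductive quotientAutomaton [LinearOrder S] (G : GameGraph V) (s₀ : S)
    (δ : AutState (S × V) → V → AutState (S × V) → Prop) (R : S → S → Prop) :
    AutState (MemClass R × V) → V → AutState (MemClass R × V) → Prop where
  | start (v' : V) : quotientAutomaton G s₀ δ R .start v' (.state (MemClass.mk R s₀, v'))
  | edge (C : MemClass R) (v v' : V) (t : S) (h : G.edge v v')
      (ht : IsLeast {t | ∃ s ∈ C.1, δ (.state (s, v)) v' (.state (t, v'))} t) :
      quotientAutomaton G s₀ δ R (.state (C, v)) v' (.state (MemClass.mk R t, v'))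
  | toSink (C : MemClass R) (v v' : V) (h : ¬ G.edge v v') :
      quotientAutomaton G s₀ δ R (.state (C, v)) v' .sink
  | sink (v' : V) : quotientAutomaton G s₀ δ R .sink v' .sink

/-- The arena of the automaton game of a game automaton. -/
def automatonGraph (V0 : Set V) (δ : AutState (S × V) → V → AutState (S × V) → Prop) :
    GameGraph (S × V) where
  V0 := {p | p.2 ∈ V0}
  edge p q := ∃ a : V, δ (.state p) a (.state q)

end Reduction

/-- An arena with vertex set `Mem × V`; the elements of `Mem` are its memory contents. -/
structure MemoryGraph (V : Type) where
  Mem : Type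
  graph : GameGraph (Mem × V)

/-- The reduced game graph that memory reduction computes for a Streett game: simulate it by a parity
game, view this as a game automaton with the complemented colouring (a `min`-parity automaton),
reduce the automaton by right-hand delayed simulation, and view the quotient as a game again. -/
def StreettGame.reducedGraph {V : Type} {m : ℕ} [LinearOrder (IAR m)] (Γ : StreettGame V m) :
    MemoryGraph V where
  Mem := MemClass (memEquiv Γ.iarGraph (fun p => 2 * (m + 1) - iarColor p))
  graph := automatonGraph Γ.V0 (quotientAutomaton Γ.toGameGraph (IAR.initial m)
    (gameAutomaton Γ.toGameGraph Γ.iarGraph (IAR.initial m))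
    (memEquiv Γ.iarGraph (fun p => 2 * (m + 1) - iarColor p)))

/-! ### The example -/

/-- The vertices of `G_k`. The numbers `1, …, k` are represented by `Fin k`. The vertices
`p j true`, `p j false` are the upper and the lower successor of `v j`, and `r j true`, `r j false`
are the upper and the lower successor of `w j`. -/
inductive Vert (k : ℕ) where
  | v (j : Fin k) : Vert k
  | p (j : Fin k) (up : Bool) : Vert k
  | w (j : Fin k) : Vert k
  | r (j : Fin k) (up : Bool) : Vert k
  | x : Vert k
  | y : Vert k

/-- The edges of `G_k`. -/
inductive exEdge (k : ℕ) : Vert k → Vert k → Prop where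
  | v_p (j : Fin k) (up : Bool) : exEdge k (.v j) (.p j up)
  | p_v (i j : Fin k) (up : Bool) (h : (i : ℕ) + 1 = j) : exEdge k (.p i up) (.v j)
  | p_w (i j : Fin k) (up : Bool) (hi : (i : ℕ) + 1 = k) (hj : (j : ℕ) = 0) :
      exEdge k (.p i up) (.w j)
  | w_r (j : Fin k) (up : Bool) : exEdge k (.w j) (.r j up)
  | r_w (i j : Fin k) (up : Bool) (h : (i : ℕ) + 1 = j) : exEdge k (.r i up) (.w j)
  | r_x (i : Fin k) (up : Bool) (hi : (i : ℕ) + 1 = k) : exEdge k (.r i up) .x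
  | x_y : exEdge k .x .y
  | y_v (j : Fin k) (hj : (j : ℕ) = 0) : exEdge k .y (.v j)

/-- The pairs are listed in the order `1, -1, 2, -2, …, k, -k`, followed by the pair `(V, V)`. -/
def idxPos {k : ℕ} (j : Fin k) : Fin (2 * k + 1) := ⟨2 * j, by omega⟩

def idxNeg {k : ℕ} (j : Fin k) : Fin (2 * k + 1) := ⟨2 * j + 1, by omega⟩

/-- The `E`-labels of the vertices, apart from the one of the pair `(V, V)`. -/
def labelE {k : ℕ} : Vert k → Set (Fin (2 * k + 1))
  | .p j true => {idxNeg j}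
  | .p j false => {idxPos j}
  | .r j true => {idxPos j}
  | .r j false => {idxNeg j}
  | .y => Set.univ
  | _ => ∅

/-- The `F`-labels of the vertices, apart from the one of the pair `(V, V)`. -/
def labelF {k : ℕ} : Vert k → Set (Fin (2 * k + 1))
  | .p j true => {idxPos j}
  | .p j false => {idxNeg j}
  | .r j true => {idxNeg j}
  | .r j false => {idxPos j}
  | _ => ∅

/-- The Streett game `Γ_k`. -/
def exGame (k : ℕ) : StreettGame (Vert k) (2 * k) where
  V0 := Set.range Vert.w
  edge := exEdge k
  E i := {u | i = Fin.last (2 * k) ∨ i ∈ labelE u}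
  F i := {u | i = Fin.last (2 * k) ∨ i ∈ labelF u}

/-! Every edge of the arena other than those leaving `y` brings a play closer to `y`, so each play
visits `y` infinitely often. Since `y` lies in every set `E i`, Player 0 wins every play, and every
strategy is winning.

Leaving `y` gives the greatest colour whatever the record is (`iarColor_update_of_forall_mem`). Its
complement is `0`, and `pm 0 0` resets to the check mark. In the simulation game both components
leave `y` simultaneously, so Duplicator wins from any two records over the same vertex
(`exGame_rhLE`). Hence all records are equivalent and the reduced graph has one memory content.

For the lower bound, let Player 1 choose a bit `b j` at each `v j` in the first round. The record
then has the index of sign `!(b j)` to the left of the one of sign `b j` (`records_update_p`), and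
answering with the other bit at `w j` produces an odd colour when the chosen vertex is left
(`odd_iarColor_update_r`). A strategy avoiding odd colours must therefore copy all `k` bits, so an
automaton implementing it is in different states at the first visit to the first `w` for different
`b`, which gives `2 ^ k` states. -/

/-! ### The order of the indices in an index appearance record -/

/-- The index `a` stands to the left of the index `b`. -/
def IAR.Before {m : ℕ} (s : IAR m) (a b : Fin (m + 1)) : Prop := s.perm.symm a < s.perm.symm b

theorem Tuple.sort_symm_lt_iff {n : ℕ} (g : Fin n → ℕ) (l l' : Fin n) :
    (Tuple.sort g).symm l < (Tuple.sort g).symm l' ↔ g l < g l' ∨ g l = g l' ∧ l < l' := by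
  have h := (Tuple.eq_sort_iff' (f := g) (σ := Tuple.sort g)).1 rfl
  rw [← h.lt_iff_lt]
  simp only [Equiv.trans_apply, Equiv.apply_symm_apply]
  exact Prod.Lex.lt_iff

/-- The position of `b` is the number of elements placed to its left, so positions can be compared
by comparing these sets. -/
theorem Equiv.Perm.apply_le_of_forall_lt {n : ℕ} (σ τ : Equiv.Perm (Fin n)) (b : Fin n)
    (h : ∀ c, σ c < σ b → τ c < τ b) : σ b ≤ τ b := by
  have hcard (ρ : Equiv.Perm (Fin n)) :
      (Finset.univ.filter fun c => ρ c < ρ b).card = (ρ b : ℕ) := by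
    rw [← Fin.card_Iio (ρ b)]
    refine Finset.card_bij (fun c _ => ρ c) (by simp) (fun _ _ _ _ h => ρ.injective h) ?_
    intro d hd
    exact ⟨ρ.symm d, by simpa using hd, by simp⟩
  rw [Fin.le_def, ← hcard σ, ← hcard τ]
  refine Finset.card_le_card fun c hc => ?_
  simp only [Finset.mem_filter, Finset.mem_univ, true_and] at hc ⊢
  exact h c hc

namespace StreettGame

variable {V : Type} {m : ℕ} (Γ : StreettGame V m)

-- The shift is a stable sort, so pairwise order alone describes it. This allows reasoning with
-- `Before` instead of computing permutations.
open Classical in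
theorem update_before_iff (s : IAR m) (v : V) (a b : Fin (m + 1)) :
    (Γ.update s v).Before a b ↔
      (v ∈ Γ.E a ∧ v ∉ Γ.E b) ∨ ((v ∈ Γ.E a ↔ v ∈ Γ.E b) ∧ s.Before a b) := by
  have h := Tuple.sort_symm_lt_iff (fun l => if v ∈ Γ.E (s.perm l) then (0 : ℕ) else 1)
    (s.perm.symm a) (s.perm.symm b)
  simp only [Equiv.apply_symm_apply] at h
  refine Iff.trans (b := _) (by exact h) ?_
  by_cases ha : v ∈ Γ.E a <;> by_cases hb : v ∈ Γ.E b <;> simp [ha, hb, IAR.Before]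

/-- The colour is odd if an index `b` with `v ∈ F b` stands to the right of all indices `a` with
`v ∈ E a`. -/
theorem odd_iarColor_update (s : IAR m) (v u : V) (b : Fin (m + 1)) (hF : v ∈ Γ.F b)
    (hE : ∀ a, v ∈ Γ.E a → s.Before a b) (hne : ∃ a, v ∈ Γ.E a) :
    Odd (iarColor (Γ.update s v, u)) := by
  classical
  -- As `b` is not shifted itself, whatever stood to its left stays there; hence its position cannot
  -- decrease. The chain is: `e` < old position of `b` ≤ new position of `b` ≤ `f`.
  have hbE : v ∉ Γ.E b := fun h => lt_irrefl _ (hE b h)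
  have hpos : s.perm.symm b ≤ (Γ.update s v).perm.symm b := by
    refine Equiv.Perm.apply_le_of_forall_lt _ _ _ fun c hc => ?_
    refine (Γ.update_before_iff s v c b).2 ?_
    by_cases h : v ∈ Γ.E c
    · exact .inl ⟨h, hbE⟩
    · exact .inr ⟨by simp [h, hbE], hc⟩
  have he : (Γ.update s v).e < s.perm.symm b := by
    -- A strict bound on a supremum needs the bound to exceed `⊥`; the index `a` to the left of `b`
    -- provides this.
    obtain ⟨a, ha⟩ := hne
    refine (Finset.sup_lt_iff (α := Fin (m + 1)) (f := id)
      (lt_of_le_of_lt bot_le (hE a ha))).2 fun l hl => ?_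
    have := hE _ (by simpa using hl)
    simpa [IAR.Before] using this
  have hf : (Γ.update s v).perm.symm b ≤ (Γ.update s v).f := by
    refine Finset.le_sup (f := id) (s := Finset.univ.filter
      (fun l => v ∈ Γ.F (Γ.shiftLeft v s.perm l))) (b := (Γ.update s v).perm.symm b) ?_
    rw [Finset.mem_filter]
    refine ⟨Finset.mem_univ _, ?_⟩
    have : Γ.shiftLeft v s.perm ((Γ.update s v).perm.symm b) = b :=
      (Γ.update s v).perm.apply_symm_apply b
    rwa [this]
  have hlt := lt_of_lt_of_le he (hpos.trans hf)
  rw [iarColor, if_neg (not_le.2 hlt)]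
  exact ⟨(Γ.update s v).f, by simp only; omega⟩

/-- The colour after a vertex that belongs to all sets `E i` is the greatest one. -/
theorem iarColor_update_of_forall_mem (s : IAR m) (v u : V) (h : ∀ i, v ∈ Γ.E i) :
    iarColor (Γ.update s v, u) = 2 * (m + 1) := by
  classical
  have he : (Γ.update s v).e = Fin.last m := by
    refine le_antisymm (Fin.le_last _) ?_
    exact Finset.le_sup (f := id) (s := Finset.univ.filter (fun l => v ∈ Γ.E (s.perm l)))
      (by simp [h])
  rw [iarColor]
  simp [he, Fin.le_last]

theorem inducedStrategy_isStrategy (f' : IAR m × V → IAR m × V)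
    (hf : Γ.iarGraph.IsPositionalStrategy f') : Γ.game.IsStrategy (Γ.inducedStrategy f') :=
  fun _ v _ hv => (hf (_, v) hv).1

end StreettGame

theorem foldl_pastOf_succ {V M : Type} (g : M → V → M) (a : M) (ρ : ℕ → V) (i : ℕ) :
    (pastOf ρ (i + 1)).foldl g a = g ((pastOf ρ i).foldl g a) (ρ i) := by
  simp [pastOf, List.range_succ]

instance IAR.instFinite (m : ℕ) : Finite (IAR m) :=
  Finite.of_injective (fun s : IAR m => (s.perm, s.e, s.f)) fun s t h => by
    cases s; cases t; simp_all

/-! ### The arena `G_k` -/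

namespace Vert

variable {k : ℕ}

instance instFinite : Finite (Vert k) := by
  refine Finite.of_surjective
    (fun t : (Fin k ⊕ Fin k × Bool) ⊕ (Fin k ⊕ Fin k × Bool) ⊕ Bool => match t with
      | .inl (.inl j) => .v j
      | .inl (.inr (j, b)) => .p j b
      | .inr (.inl (.inl j)) => .w j
      | .inr (.inl (.inr (j, b))) => .r j b
      | .inr (.inr true) => .x
      | .inr (.inr false) => .y) ?_
  rintro (j | ⟨j, b⟩ | j | ⟨j, b⟩ | _ | _)
  exacts [⟨.inl (.inl j), rfl⟩, ⟨.inl (.inr (j, b)), rfl⟩, ⟨.inr (.inl (.inl j)), rfl⟩,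
    ⟨.inr (.inl (.inr (j, b))), rfl⟩, ⟨.inr (.inr true), rfl⟩, ⟨.inr (.inr false), rfl⟩]

/-- The distance to the vertex `y`. -/
def distY : Vert k → ℕ
  | .v j => 2 * k + 2 * (k - j) + 1
  | .p j _ => 2 * k + 2 * (k - j)
  | .w j => 2 * (k - j) + 1
  | .r j _ => 2 * (k - j)
  | .x => 1
  | .y => 0

end Vert

theorem exEdge.distY_lt {k : ℕ} {u u' : Vert k} (h : exEdge k u u') (hu : u ≠ .y) :
    u'.distY < u.distY := by
  cases h <;> simp only [Vert.distY] <;> first | omega | exact absurd rfl hu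

/-- Descent on `distY`, which strictly decreases along a play until `y` is reached. -/
theorem exists_ge_eq_y {k : ℕ} {ρ : ℕ → Vert k} (h : ∀ i, exEdge k (ρ i) (ρ (i + 1))) (N : ℕ) :
    ∃ i ≥ N, ρ i = .y := by
  induction hd : (ρ N).distY using Nat.strong_induction_on generalizing N with
  | _ d ih =>
    by_cases hy : ρ N = .y
    · exact ⟨N, le_rfl, hy⟩
    · obtain ⟨i, hi, hi'⟩ := ih _ (hd ▸ (h N).distY_lt hy) (N + 1) rfl
      exact ⟨i, by omega, hi'⟩

theorem exGame_mem_win_of_isPlay {k : ℕ} {ρ : ℕ → Vert k} (h : (exGame k).game.IsPlay ρ) :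
    ρ ∈ (exGame k).game.win := by
  intro j _
  refine ⟨.y, Filter.frequently_atTop.2 fun N => ?_, ?_⟩
  · exact exists_ge_eq_y h N
  · exact .inr (Set.mem_univ _)

theorem exGame_isWinningStrategy_inducedStrategy {k : ℕ} (u : Vert k)
    (f' : IAR (2 * k) × Vert k → IAR (2 * k) × Vert k)
    (hf : (exGame k).iarGraph.IsPositionalStrategy f') :
    (exGame k).game.IsWinningStrategy ((exGame k).inducedStrategy f') u :=
  ⟨(exGame k).inducedStrategy_isStrategy f' hf, fun _ h _ _ => exGame_mem_win_of_isPlay h⟩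

theorem exGame_wins {k : ℕ} (u : Vert k) : (exGame k).game.Wins u := by
  classical
  refine ⟨fun _ v => if h : ∃ v', exEdge k v v' then h.choose else v, ?_,
    fun _ h _ _ => exGame_mem_win_of_isPlay h⟩
  rintro h v - ⟨j, rfl⟩
  have hex : ∃ v', exEdge k (.w j) v' := ⟨_, .w_r j true⟩
  simp only [dif_pos hex]
  exact hex.choose_spec

/-! ### The reduced game graph -/

/-- Pigeonhole: a finite set visited infinitely often has a single element that recurs. -/
theorem infOcc_inter_nonempty {α : Type} {ρ : ℕ → α} {T : Set α} (hT : T.Finite)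
    (h : ∀ N, ∃ i ≥ N, ρ i ∈ T) : (infOcc ρ ∩ T).Nonempty := by
  by_contra hne
  have hev : ∀ a ∈ T, ∀ᶠ i in Filter.atTop, ρ i ≠ a := fun a ha => by
    by_contra hfr
    exact hne ⟨a, by simpa [infOcc, Filter.Frequently] using hfr, ha⟩
  obtain ⟨N, hN⟩ := Filter.eventually_atTop.1 ((Filter.eventually_all_finite hT).2 hev)
  obtain ⟨i, hi, hp⟩ := h N
  exact hN i hi _ hp rfl

theorem pm_zero_zero (o : Option ℕ) : pm 0 0 o = none := by
  cases o <;> simp [pm, rewardLT]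

theorem exGame_rhLE {k : ℕ} (s t : IAR (2 * k)) (u : Vert k) :
    rhLE (exGame k).iarGraph (fun p => 2 * (2 * k + 1) - iarColor p) (s, u) (t, u) := by
  refine ⟨fun _ v => v, fun _ _ _ h => absurd h (Set.notMem_empty _), fun ρ hρ h0 _ => ?_⟩
  -- Spoiler must move both components to the same arena vertex, so they reach `y` at the same time.
  have hsame : ∀ i, (ρ i).1.2 = (ρ i).2.1.2 := by
    rintro (_ | i)
    · rw [h0]; rfl
    · exact (hρ i).2.2.1
  refine infOcc_inter_nonempty ?_ fun N => ?_
  -- The third component ranges over an infinite type, but it is fixed to `none` here, leaving only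
  -- pairs from a finite set.
  · refine (Set.finite_range fun a : (IAR (2 * k) × Vert k) × (IAR (2 * k) × Vert k) =>
      (a.1, a.2, (none : Option ℕ))).subset ?_
    rintro ⟨p, q, o⟩ (rfl : o = none)
    exact ⟨(p, q), rfl⟩
  · obtain ⟨i, hi, hy⟩ := exists_ge_eq_y (ρ := fun i => (ρ i).1.2) (fun i => (hρ i).1.1) N
    -- Colours reflect the vertex just left, so the check mark appears one step after `y`.
    refine ⟨i + 1, by omega, ?_⟩
    obtain ⟨⟨-, hp⟩, ⟨-, hq⟩, -, ho⟩ := hρ i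
    have hcol : ∀ p q : IAR (2 * k) × Vert k, p.2 = .y → q.1 = (exGame k).update p.1 p.2 →
        2 * (2 * k + 1) - iarColor q = 0 := by
      rintro ⟨p, v⟩ ⟨q, w⟩ rfl rfl
      rw [(exGame k).iarColor_update_of_forall_mem]
      · exact Nat.sub_self _
      · exact fun i => .inr (Set.mem_univ i)
    simp only [hcol _ _ hy hp, hcol _ _ ((hsame i).symm.trans hy) hq, pm_zero_zero] at ho
    exact ho

theorem natCard_memClass_eq_one {S : Type} [Nonempty S] {R : S → S → Prop} (h : ∀ s t, R s t) :
    Nat.card (MemClass R) = 1 := by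
  rw [Nat.card_eq_one_iff_exists]
  refine ⟨MemClass.mk R (Classical.arbitrary S), ?_⟩
  rintro ⟨C, s, rfl⟩
  exact Subtype.ext (by simp [MemClass.mk, h])

theorem exGame_natCard_mem_reducedGraph (k : ℕ) [LinearOrder (IAR (2 * k))] :
    Nat.card (exGame k).reducedGraph.Mem = 1 :=
  haveI : Nonempty (IAR (2 * k)) := ⟨IAR.initial _⟩
  natCard_memClass_eq_one fun s t u => ⟨exGame_rhLE s t u, exGame_rhLE t s u⟩

/-! ### Plays in which Player 1 chooses freely -/

section Play

variable {k : ℕ}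

/-- The indices `j` and `-j`. -/
def idxSigned (j : Fin k) : Bool → Fin (2 * k + 1)
  | true => idxPos j
  | false => idxNeg j

theorem idxSigned_inj {i j : Fin k} {a b : Bool} :
    idxSigned i a = idxSigned j b ↔ i = j ∧ a = b := by
  cases a <;> cases b <;> simp [idxSigned, idxPos, idxNeg, Fin.ext_iff] <;> omega

theorem idxSigned_ne_last (j : Fin k) (a : Bool) : idxSigned j a ≠ Fin.last (2 * k) := by
  cases a <;> simp [idxSigned, idxPos, idxNeg, Fin.ext_iff] <;> omega

theorem mem_E_p {j : Fin k} {a : Bool} {i : Fin (2 * k + 1)} :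
    Vert.p j a ∈ (exGame k).E i ↔ i = Fin.last (2 * k) ∨ i = idxSigned j (!a) := by
  cases a <;> rfl

theorem mem_E_r {j : Fin k} {a : Bool} {i : Fin (2 * k + 1)} :
    Vert.r j a ∈ (exGame k).E i ↔ i = Fin.last (2 * k) ∨ i = idxSigned j a := by
  cases a <;> rfl

theorem mem_F_r {j : Fin k} {a : Bool} {i : Fin (2 * k + 1)} :
    Vert.r j a ∈ (exGame k).F i ↔ i = Fin.last (2 * k) ∨ i = idxSigned j (!a) := by
  cases a <;> rfl

theorem mem_E_v {j : Fin k} {i : Fin (2 * k + 1)} :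
    Vert.v j ∈ (exGame k).E i ↔ i = Fin.last (2 * k) := by
  simp [exGame, labelE]

theorem mem_E_w {j : Fin k} {i : Fin (2 * k + 1)} :
    Vert.w j ∈ (exGame k).E i ↔ i = Fin.last (2 * k) := by
  simp [exGame, labelE]

/-- The index of the pair `(V, V)` stands at the leftmost position. -/
def LastIsFirst (s : IAR (2 * k)) : Prop :=
  ∀ c, c ≠ Fin.last (2 * k) → s.Before (Fin.last (2 * k)) c

/-- The last index lies in every `E`-label, so it is always among the shifted indices and, by
stability, remains their first. -/
theorem LastIsFirst.update {s : IAR (2 * k)} (hs : LastIsFirst s) (u : Vert k) :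
    LastIsFirst ((exGame k).update s u) := by
  intro c hc
  have hl : u ∈ (exGame k).E (Fin.last (2 * k)) := .inl rfl
  rw [StreettGame.update_before_iff]
  by_cases h : u ∈ (exGame k).E c
  · exact .inr ⟨by simp [hl, h], hs c hc⟩
  · exact .inl ⟨hl, h⟩

theorem lastIsFirst_update_v (s : IAR (2 * k)) (j : Fin k) :
    LastIsFirst ((exGame k).update s (.v j)) := by
  intro c hc
  rw [StreettGame.update_before_iff]
  exact .inl ⟨mem_E_v.2 rfl, fun h => hc (mem_E_v.1 h)⟩

/-- The winner of the last comparison of `j` and `-j` stands to the left: `-j` if `a` is true. -/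
def Records (s : IAR (2 * k)) (j : Fin k) (a : Bool) : Prop :=
  s.Before (idxSigned j (!a)) (idxSigned j a)

theorem Records.update {s : IAR (2 * k)} {j : Fin k} {a : Bool} (hs : Records s j a) {u : Vert k}
    (hu : ∀ b, u ∉ (exGame k).E (idxSigned j b)) : Records ((exGame k).update s u) j a := by
  rw [Records, StreettGame.update_before_iff]
  exact .inr ⟨by simp [hu], hs⟩

/-- Only the index of sign `!a` among the two is shifted, which overwrites any earlier order. -/
theorem records_update_p (s : IAR (2 * k)) (j : Fin k) (a : Bool) :
    Records ((exGame k).update s (.p j a)) j a := by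
  rw [Records, StreettGame.update_before_iff]
  refine .inl ⟨mem_E_p.2 (.inr rfl), fun h => ?_⟩
  rcases mem_E_p.1 h with h | h
  · exact idxSigned_ne_last _ _ h
  · cases a <;> simp [idxSigned_inj] at h

/-- The two indices whose `E`-set contains this vertex, the last one and that of sign `!a`, both
stand to the left of the index of sign `a`, whose `F`-set contains it. -/
theorem odd_iarColor_update_r {s : IAR (2 * k)} {j : Fin k} {a : Bool} (hl : LastIsFirst s)
    (hs : Records s j a) (u : Vert k) : Odd (iarColor ((exGame k).update s (.r j (!a)), u)) := by
  refine StreettGame.odd_iarColor_update _ s _ u (idxSigned j a) (mem_F_r.2 ?_) (fun c hc => ?_)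
    ⟨_, .inl rfl⟩
  · simp
  · rcases mem_E_r.1 hc with rfl | rfl
    · exact hl _ (idxSigned_ne_last _ _)
    · exact hs

/-- The moves of Player 1 in which she chooses `p j (b j)` at the vertex `v j`. -/
def challenge (hk : 1 ≤ k) (b : Fin k → Bool) : Vert k → Vert k
  | .v j => .p j (b j)
  | .p j _ => if h : (j : ℕ) + 1 < k then .v ⟨j + 1, h⟩ else .w ⟨0, hk⟩
  -- A dummy value: at `w j` the play follows `f'` instead.
  | .w j => .r j true
  | .r j _ => if h : (j : ℕ) + 1 < k then .w ⟨j + 1, h⟩ else .x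
  | .x => .y
  | .y => .v ⟨0, hk⟩

theorem exEdge_challenge (hk : 1 ≤ k) (b : Fin k → Bool) (u : Vert k) :
    exEdge k u (challenge hk b u) := by
  cases u with
  | v j => exact .v_p _ _
  | p j a =>
    rw [challenge]
    split_ifs with h
    · exact .p_v _ _ _ rfl
    · exact .p_w _ _ _ (by omega) rfl
  | w j => exact .w_r _ _
  | r j a =>
    rw [challenge]
    split_ifs with h
    · exact .r_w _ _ _ rfl
    · exact .r_x _ _ (by omega)
  | x => exact .x_y
  | y => exact .y_v _ rfl

open Classical in
/-- The play in the simulating game in which Player 0 follows `f'` and Player 1 plays according to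
`challenge`. -/
noncomputable def challengePlay (hk : 1 ≤ k) (f' : IAR (2 * k) × Vert k → IAR (2 * k) × Vert k)
    (b : Fin k → Bool) : ℕ → IAR (2 * k) × Vert k
  | 0 => (IAR.initial (2 * k), .v ⟨0, hk⟩)
  | i + 1 =>
    let q := challengePlay hk f' b i
    if q ∈ (exGame k).iarGraph.V0 then f' q
    else ((exGame k).update q.1 q.2, challenge hk b q.2)

variable {hk : 1 ≤ k} {f' : IAR (2 * k) × Vert k → IAR (2 * k) × Vert k} {b : Fin k → Bool}

theorem challengePlay_succ_of_mem {i : ℕ}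
    (h : challengePlay hk f' b i ∈ (exGame k).iarGraph.V0) :
    challengePlay hk f' b (i + 1) = f' (challengePlay hk f' b i) := by
  simp [challengePlay, h]

theorem challengePlay_succ_of_notMem {i : ℕ}
    (h : challengePlay hk f' b i ∉ (exGame k).iarGraph.V0) :
    challengePlay hk f' b (i + 1) = ((exGame k).update (challengePlay hk f' b i).1
      (challengePlay hk f' b i).2, challenge hk b (challengePlay hk f' b i).2) := by
  simp [challengePlay, h]

theorem positionalEdge_challengePlay (hf : (exGame k).iarGraph.IsPositionalStrategy f') (i : ℕ) :
    (exGame k).iarGraph.positionalEdge f' (challengePlay hk f' b i)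
      (challengePlay hk f' b (i + 1)) := by
  by_cases h : challengePlay hk f' b i ∈ (exGame k).iarGraph.V0
  · rw [challengePlay_succ_of_mem h]
    exact ⟨hf _ h, fun _ => rfl⟩
  · rw [challengePlay_succ_of_notMem h]
    exact ⟨⟨exEdge_challenge _ _ _, rfl⟩, fun h' => absurd h' h⟩

theorem challengePlay_mem_reachableUnder (hf : (exGame k).iarGraph.IsPositionalStrategy f')
    (i : ℕ) : challengePlay hk f' b i ∈
      (exGame k).iarGraph.reachableUnder f' (IAR.initial (2 * k), .v ⟨0, hk⟩) := by
  induction i with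
  | zero => exact .refl
  | succ i ih => exact ih.tail (positionalEdge_challengePlay hf i)

theorem challengePlay_succ_fst (hf : (exGame k).iarGraph.IsPositionalStrategy f') (i : ℕ) :
    (challengePlay hk f' b (i + 1)).1 =
      (exGame k).update (challengePlay hk f' b i).1 (challengePlay hk f' b i).2 :=
  (positionalEdge_challengePlay hf i).1.2

theorem challengePlay_succ_snd {i : ℕ} (h : (challengePlay hk f' b i).2 ∉ Set.range Vert.w) :
    (challengePlay hk f' b (i + 1)).2 = challenge hk b (challengePlay hk f' b i).2 := by
  rw [challengePlay_succ_of_notMem h]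

/-- The memory of the induced strategy is the record component of the play, so projecting to the
arena gives a play according to that strategy. -/
theorem foldl_pastOf_challengePlay (hf : (exGame k).iarGraph.IsPositionalStrategy f') (i : ℕ) :
    (pastOf (fun i => (challengePlay hk f' b i).2) i).foldl (exGame k).update
      (IAR.initial (2 * k)) = (challengePlay hk f' b i).1 := by
  induction i with
  | zero => rfl
  | succ i ih => rw [foldl_pastOf_succ, ih, challengePlay_succ_fst hf]

theorem inducedStrategy_challengePlay (hf : (exGame k).iarGraph.IsPositionalStrategy f') {i : ℕ}
    (h : (challengePlay hk f' b i).2 ∈ Set.range Vert.w) :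
    (exGame k).inducedStrategy f' (pastOf (fun i => (challengePlay hk f' b i).2) i)
      (challengePlay hk f' b i).2 = (challengePlay hk f' b (i + 1)).2 := by
  rw [StreettGame.inducedStrategy, foldl_pastOf_challengePlay hf, challengePlay_succ_of_mem h]

/-- In the first half of the first round the choices of Player 1 are recorded. -/
theorem challengePlay_first_half (hf : (exGame k).iarGraph.IsPositionalStrategy f') (i : ℕ)
    (hi : i ≤ k) :
    (challengePlay hk f' b (2 * i)).2 = (if h : i < k then .v ⟨i, h⟩ else .w ⟨0, hk⟩) ∧
    (0 < i → LastIsFirst (challengePlay hk f' b (2 * i)).1) ∧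
    ∀ j : Fin k, (j : ℕ) < i → Records (challengePlay hk f' b (2 * i)).1 j (b j) := by
  induction i with
  | zero =>
    -- In the initial record the last index is rightmost; it reaches the front only when the first
    -- `v` is left. Hence the condition `0 < i`.
    refine ⟨?_, fun h => absurd h (lt_irrefl _), fun j hj => absurd hj (Nat.not_lt_zero _)⟩
    rw [dif_pos (by omega : 0 < k)]
    rfl
  | succ i ih =>
    obtain ⟨hv, -, hrec⟩ := ih (by omega)
    have hik : i < k := hi
    rw [dif_pos hik] at hv
    have hp : (challengePlay hk f' b (2 * i + 1)).2 = .p ⟨i, hik⟩ (b ⟨i, hik⟩) := by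
      rw [challengePlay_succ_snd (by simp [hv]), hv, challenge]
    have hm : (challengePlay hk f' b (2 * (i + 1))).1 = (exGame k).update ((exGame k).update
        (challengePlay hk f' b (2 * i)).1 (.v ⟨i, hik⟩)) (.p ⟨i, hik⟩ (b ⟨i, hik⟩)) := by
      rw [show 2 * (i + 1) = 2 * i + 1 + 1 by ring, challengePlay_succ_fst hf, hp,
        challengePlay_succ_fst hf, hv]
    rw [hm]
    refine ⟨?_, fun _ => (lastIsFirst_update_v _ _).update _, fun j hj => ?_⟩
    · rw [show 2 * (i + 1) = 2 * i + 1 + 1 by ring, challengePlay_succ_snd (by simp [hp]), hp,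
        challenge]
    · rcases Nat.lt_succ_iff_lt_or_eq.1 hj with hj | hj
      · refine ((hrec j hj).update fun a h => ?_).update fun a h => ?_
        · exact idxSigned_ne_last _ _ (mem_E_v.1 h)
        · rcases mem_E_p.1 h with h | h
          · exact idxSigned_ne_last _ _ h
          · have := congrArg Fin.val (idxSigned_inj.1 h).1
            simp only at this
            omega
      · obtain rfl : j = ⟨i, hik⟩ := Fin.ext hj
        exact records_update_p _ _ _

/-- If a strategy avoids odd colours, then the recorded choice is copied. -/
theorem challengePlay_copies (hf : (exGame k).iarGraph.IsPositionalStrategy f')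
    (heven : ∀ a ∈ (exGame k).iarGraph.determinedEdges f' (IAR.initial (2 * k), .v ⟨0, hk⟩),
      ¬ Odd (iarColor a.2)) {i : ℕ} {j : Fin k} (hw : (challengePlay hk f' b i).2 = .w j)
    (hl : LastIsFirst (challengePlay hk f' b i).1)
    (hr : Records (challengePlay hk f' b i).1 j (b j)) :
    (challengePlay hk f' b (i + 1)).2 = .r j (b j) := by
  have hV0 : challengePlay hk f' b i ∈ (exGame k).iarGraph.V0 := ⟨j, hw.symm⟩
  have hedge : exEdge k (challengePlay hk f' b i).2 (challengePlay hk f' b (i + 1)).2 :=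
    (positionalEdge_challengePlay hf i).1.1
  rw [hw] at hedge
  obtain ⟨a, ha⟩ : ∃ a, (challengePlay hk f' b (i + 1)).2 = .r j a := by
    generalize (challengePlay hk f' b (i + 1)).2 = u at hedge
    cases hedge
    exact ⟨_, rfl⟩
  by_contra hne
  obtain rfl : a = !b j := by
    cases a <;> cases hb : b j <;> simp_all
  -- The offending edge is the one after her choice: the colour caused by the vertex `r` shows at
  -- its successor.
  refine heven (challengePlay hk f' b (i + 1), challengePlay hk f' b (i + 1 + 1))
    ⟨challengePlay_mem_reachableUnder hf _, positionalEdge_challengePlay hf _,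
      .inr ⟨_, challengePlay_mem_reachableUnder hf i, hV0,
        (challengePlay_succ_of_mem hV0).symm⟩⟩ ?_
  have hodd := odd_iarColor_update_r (s := (exGame k).update (challengePlay hk f' b i).1 (.w j))
    (hl.update _) (hr.update fun c h => idxSigned_ne_last _ _ (mem_E_w.1 h))
    (challengePlay hk f' b (i + 1 + 1)).2
  rwa [← hw, ← challengePlay_succ_fst hf, ← ha, ← challengePlay_succ_fst hf] at hodd

/-- In the second half of the first round Player 0 copies the choices of Player 1. -/
theorem challengePlay_second_half (hf : (exGame k).iarGraph.IsPositionalStrategy f')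
    (heven : ∀ a ∈ (exGame k).iarGraph.determinedEdges f' (IAR.initial (2 * k), .v ⟨0, hk⟩),
      ¬ Odd (iarColor a.2)) (i : ℕ) (hi : i < k) :
    (challengePlay hk f' b (2 * k + 2 * i)).2 = .w ⟨i, hi⟩ ∧
    (challengePlay hk f' b (2 * k + 2 * i + 1)).2 = .r ⟨i, hi⟩ (b ⟨i, hi⟩) ∧
    LastIsFirst (challengePlay hk f' b (2 * k + 2 * i)).1 ∧
    ∀ j : Fin k, i ≤ j → Records (challengePlay hk f' b (2 * k + 2 * i)).1 j (b j) := by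
  induction i with
  | zero =>
    obtain ⟨hw, hl, hr⟩ := challengePlay_first_half (hk := hk) (b := b) hf k le_rfl
    rw [dif_neg (lt_irrefl k)] at hw
    exact ⟨hw, challengePlay_copies hf heven hw (hl hk) (hr _ hk), hl hk, fun j _ => hr j j.2⟩
  | succ i ih =>
    obtain ⟨hw, hr, hl, hrec⟩ := ih (by omega)
    have hw' : (challengePlay hk f' b (2 * k + 2 * (i + 1))).2 = .w ⟨i + 1, hi⟩ := by
      rw [show 2 * k + 2 * (i + 1) = 2 * k + 2 * i + 1 + 1 by ring,
        challengePlay_succ_snd (by simp [hr]), hr, challenge, dif_pos hi]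
    have hm : (challengePlay hk f' b (2 * k + 2 * (i + 1))).1 = (exGame k).update
        ((exGame k).update (challengePlay hk f' b (2 * k + 2 * i)).1 (.w ⟨i, by omega⟩))
        (.r ⟨i, by omega⟩ (b ⟨i, by omega⟩)) := by
      rw [show 2 * k + 2 * (i + 1) = 2 * k + 2 * i + 1 + 1 by ring, challengePlay_succ_fst hf, hr,
        challengePlay_succ_fst hf, hw]
    have hl' : LastIsFirst (challengePlay hk f' b (2 * k + 2 * (i + 1))).1 := by
      rw [hm]
      exact (hl.update _).update _
    -- The bit at `i` is dropped from the invariant, since leaving the copied `r` shifts the index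
    -- of sign `b i` to the left.
    have hrec' : ∀ j : Fin k, i + 1 ≤ j →
        Records (challengePlay hk f' b (2 * k + 2 * (i + 1))).1 j (b j) := by
      intro j hj
      rw [hm]
      refine ((hrec j (by omega)).update fun a h => ?_).update fun a h => ?_
      · exact idxSigned_ne_last _ _ (mem_E_w.1 h)
      · rcases mem_E_r.1 h with h | h
        · exact idxSigned_ne_last _ _ h
        · have := congrArg Fin.val (idxSigned_inj.1 h).1
          simp only at this
          omega
    exact ⟨hw', challengePlay_copies hf heven hw' hl' (hrec' _ le_rfl), hl', hrec'⟩

/-- Time `2 * k` is the first visit to the first `w`. From there the vertices read depend only on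
the copied bits, so the state at that time determines all of `b`. -/
theorem two_pow_memorySizeAtLeast (hk : 1 ≤ k)
    (hf : (exGame k).iarGraph.IsPositionalStrategy f')
    (heven : ∀ a ∈ (exGame k).iarGraph.determinedEdges f' (IAR.initial (2 * k), .v ⟨0, hk⟩),
      ¬ Odd (iarColor a.2)) :
    memorySizeAtLeast (exGame k).toGameGraph ((exGame k).inducedStrategy f') (.v ⟨0, hk⟩)
      (2 ^ k) := by
  intro M _ hM
  let ρ (b : Fin k → Bool) (i : ℕ) : Vert k := (challengePlay hk f' b i).2
  let st (b : Fin k → Bool) (i : ℕ) : M.Mem := (pastOf (ρ b) i).foldl M.next M.init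
  have hst (b i) : st b (i + 1) = M.next (st b i) (ρ b i) := foldl_pastOf_succ _ _ _ _
  have hout (b : Fin k → Bool) (i : ℕ) (hi : i < k) :
      M.out (st b (2 * k + 2 * i)) (.w ⟨i, hi⟩) = .r ⟨i, hi⟩ (b ⟨i, hi⟩) := by
    obtain ⟨hw, hr, -⟩ := challengePlay_second_half (hk := hk) (b := b) hf heven i hi
    have h := hM (ρ b) (fun i => (positionalEdge_challengePlay hf i).1.1) rfl
      (fun i hi => (inducedStrategy_challengePlay hf hi).symm) (2 * k + 2 * i) ⟨_, hw.symm⟩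
    rw [inducedStrategy_challengePlay hf ⟨_, hw.symm⟩, hr] at h
    rw [← h, ← hw]
  have hinj : Function.Injective fun b => st b (2 * k) := by
    intro b b' (h : st b (2 * k) = st b' (2 * k))
    have hb (i : ℕ) (hi : i < k) (h : st b (2 * k + 2 * i) = st b' (2 * k + 2 * i)) :
        b ⟨i, hi⟩ = b' ⟨i, hi⟩ := by
      have := hout b i hi
      rw [h, hout b' i hi] at this
      exact (Vert.r.inj this).2.symm
    -- Equal states output equal bits, so both plays read the same `w` and `r` and the states stay
    -- equal.
    have hall (i : ℕ) (hi : i < k) : st b (2 * k + 2 * i) = st b' (2 * k + 2 * i) := by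
      induction i with
      | zero => exact h
      | succ i ih =>
        have hik : i < k := by omega
        obtain ⟨hw, hr, -⟩ := challengePlay_second_half (hk := hk) (b := b) hf heven i hik
        obtain ⟨hw', hr', -⟩ := challengePlay_second_half (hk := hk) (b := b') hf heven i hik
        rw [show 2 * k + 2 * (i + 1) = 2 * k + 2 * i + 1 + 1 by ring, hst, hst, hst b', hst b',
          ih hik]
        simp only [ρ, hw, hr, hw', hr', hb i hik (ih hik)]
    exact funext fun i => hb i i.2 (hall i i.2)
  simpa using Nat.card_le_card_of_injective _ hinj

end Play

theorem mainTheorem2 (k : ℕ) (hk : 1 ≤ k) :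
    (exGame k).game.Wins (Vert.v ⟨0, hk⟩) ∧
    (∀ f' : IAR (2 * k) × Vert k → IAR (2 * k) × Vert k,
      (exGame k).iarGraph.IsPositionalStrategy f' →
      (exGame k).simulatingGame.IsWinningStrategy (fun _ p => f' p)
        (IAR.initial (2 * k), Vert.v ⟨0, hk⟩) →
      ((fun a => iarColor a.2) '' (exGame k).iarGraph.determinedEdges f'
        (IAR.initial (2 * k), Vert.v ⟨0, hk⟩)) ∩ {n | Odd n} = ∅ →
      (exGame k).game.IsWinningStrategy ((exGame k).inducedStrategy f') (Vert.v ⟨0, hk⟩) ∧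
      memorySizeAtLeast (exGame k).toGameGraph ((exGame k).inducedStrategy f')
        (Vert.v ⟨0, hk⟩) (2 ^ k)) ∧
    (∀ [LinearOrder (IAR (2 * k))], Nat.card (exGame k).reducedGraph.Mem = 1) :=
  ⟨exGame_wins _, fun f' hf _ heven =>
    ⟨exGame_isWinningStrategy_inducedStrategy _ f' hf,
      two_pow_memorySizeAtLeast hk hf fun a ha hodd =>
        Set.eq_empty_iff_forall_notMem.1 heven _ ⟨⟨a, ha, rfl⟩, hodd⟩⟩,
    exGame_natCard_mem_reducedGraph k⟩
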